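/- A $\mathbb{Q}$-weighted automaton over a finite alphabet $\Sigma$ with finite state set $Q$ consists of a matrix $M(a)\in\mathbb{Q}^{Q\times Q}$ for every letter $a\in\Sigma$, an initial row vector $\alpha\in\mathbb{Q}^Q$ and a final column vector $\eta\in\mathbb{Q}^Q$; it assigns to a word $w=a_1\cdots a_k\in\Sigma^*$ the weight $\alpha M(a_1)\cdots M(a_k)\eta$. It is an image-binary finite automaton (IFA) if the weight of every word is $0$ or $1$; its language is then the set of words of weight $1$. Converting IFAs to nondeterministic finite automata (NFAs) requires a super-polynomial state blowup, even over a one-letter alphabet. Precisely: let $\Sigma$ be any nonempty finite alphabet. For every $c\in\mathbb{N}$ there is $n_0\in\mathbb{N}$ such that for every $n\ge n_0$ there is an IFA over $\Sigma$ with $n$ states such that every NFA over $\Sigma$ (with any number of initial states) that accepts the same language has more than $n^c$ states. -/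

import Mathlib

/-- A weighted automaton over the ring of weights `F`, with alphabet `A` and set of states `Q`:
a transition matrix for every letter, an initial row vector and a final column vector. -/
structure WeightedAutomaton (F A Q : Type*) where
  /-- The transition matrix of a letter. -/
  trans : A → Matrix Q Q F
  /-- The initial (row) vector. -/
  init : Q → F
  /-- The final (column) vector. -/
  final : Q → F

namespace WeightedAutomaton

variable {F A Q : Type*} [Semiring F] [Fintype Q] [DecidableEq Q]

/-- The transition matrix of a word: the product, from left to right, of the matrices of its
letters (the identity matrix for the empty word). -/
def wordTrans (W : WeightedAutomaton F A Q) (w : List A) : Matrix Q Q F :=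
  (w.map W.trans).prod

/-- The weight of a word: initial vector times transition matrix of the word times final vector. -/
def weight (W : WeightedAutomaton F A Q) (w : List A) : F :=
  W.init ⬝ᵥ (Matrix.mulVec (W.wordTrans w) W.final)

/-- A weighted automaton is image-binary if the weight of every word is `0` or `1`. -/
def IsImageBinary (W : WeightedAutomaton F A Q) : Prop :=
  ∀ w : List A, W.weight w = 0 ∨ W.weight w = 1

/-- The set of the words of weight `1`. For an image-binary automaton this is the language
that it defines. -/
def accepts (W : WeightedAutomaton F A Q) : Language A :=
  {w : List A | W.weight w = 1}

end WeightedAutomaton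

/-! The blowup comes from a gap between degree and sensitivity of a Boolean function. "Not all
equal" of three bits is a polynomial of degree 2; its ternary tree of height `k` has degree `2 ^ k`,
yet at the zero input flipping any one of the `3 ^ k` leaves flips the root. Feed the leaves with
the tests `p i ∣ t`, for distinct primes of size about `P`. Sums and tensor products of linear
representations give a weighted automaton with `O(P ^ 2 ^ k)` states. The complement accepts lengths
`t` divisible by no `p i` and rejects those divisible by exactly one. Pumping an NFA run at a cycle
of length `l` therefore forces every `p i` to divide `l` (`prod_dvd_of_treeSeq_eq_one`), so the NFA
has more than `P ^ 3 ^ k` states. Choosing `k` with `c * 2 ^ k < 3 ^ k` beats the exponent `c`. -/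

/-- The sequence `f` is of the form `t ↦ φ (T ^ t v)` for a linear endomorphism `T` of a rational
vector space of dimension at most `D`. -/
def HasLinearRep (D : ℕ) (f : ℕ → ℚ) : Prop :=
  ∃ (E : Type) (_ : AddCommGroup E) (_ : Module ℚ E) (_ : Module.Finite ℚ E)
    (T : E →ₗ[ℚ] E) (v : E) (φ : E →ₗ[ℚ] ℚ),
    Module.finrank ℚ E ≤ D ∧ ∀ t, f t = φ ((T ^ t) v)

namespace HasLinearRep

variable {D D' : ℕ} {f g : ℕ → ℚ}

theorem mono (hf : HasLinearRep D f) (h : D ≤ D') : HasLinearRep D' f := by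
  obtain ⟨E, _, _, _, T, v, φ, hD, hφ⟩ := hf
  exact ⟨E, _, _, inferInstance, T, v, φ, hD.trans h, hφ⟩

theorem add (hf : HasLinearRep D f) (hg : HasLinearRep D' g) :
    HasLinearRep (D + D') (fun t => f t + g t) := by
  obtain ⟨E, _, _, _, T, v, φ, hD, hφ⟩ := hf
  obtain ⟨E', _, _, _, T', v', φ', hD', hφ'⟩ := hg
  refine ⟨E × E', inferInstance, inferInstance, inferInstance, T.prodMap T', (v, v'),
    φ.coprod φ', ?_, fun t => ?_⟩
  · rw [Module.finrank_prod]; omega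
  · have h : ∀ t, ((T.prodMap T') ^ t) (v, v') = ((T ^ t) v, (T' ^ t) v') := by
      intro t
      induction t with
      | zero => simp
      | succ t ih => simp [pow_succ', ih]
    simp [h, hφ, hφ']

theorem mul (hf : HasLinearRep D f) (hg : HasLinearRep D' g) :
    HasLinearRep (D * D') (fun t => f t * g t) := by
  obtain ⟨E, _, _, _, T, v, φ, hD, hφ⟩ := hf
  obtain ⟨E', _, _, _, T', v', φ', hD', hφ'⟩ := hg
  refine ⟨TensorProduct ℚ E E', inferInstance, inferInstance, inferInstance,
    TensorProduct.map T T', TensorProduct.tmul ℚ v v',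
    TensorProduct.lift ((LinearMap.mul ℚ ℚ).compl₁₂ φ φ'), ?_, fun t => ?_⟩
  · rw [Module.finrank_tensorProduct]; exact Nat.mul_le_mul hD hD'
  · rw [TensorProduct.map_pow]
    simp [hφ, hφ']

theorem const_mul (r : ℚ) (hf : HasLinearRep D f) : HasLinearRep D (fun t => r * f t) := by
  obtain ⟨E, _, _, _, T, v, φ, hD, hφ⟩ := hf
  exact ⟨E, _, _, inferInstance, T, v, r • φ, hD, fun t => by simp [hφ]⟩

theorem sub (hf : HasLinearRep D f) (hg : HasLinearRep D' g) :
    HasLinearRep (D + D') (fun t => f t - g t) := by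
  simpa [sub_eq_add_neg] using hf.add (hg.const_mul (-1))

theorem const (r : ℚ) : HasLinearRep 1 (fun _ => r) :=
  ⟨ℚ, _, _, inferInstance, 1, r, 1, by simp, fun t => by simp⟩

theorem dvd_indicator (m : ℕ) (hm : m ≠ 0) :
    HasLinearRep m (fun t => if m ∣ t then 1 else 0) := by
  have : NeZero m := ⟨hm⟩
  refine ⟨ZMod m → ℚ, inferInstance, inferInstance, inferInstance,
    LinearMap.funLeft ℚ ℚ (fun x => x + 1), Pi.single 0 1, LinearMap.proj 0, ?_, fun t => ?_⟩
  · simp [ZMod.card]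
  · have h : ∀ (t : ℕ) (u : ZMod m → ℚ) (x : ZMod m),
        ((LinearMap.funLeft ℚ ℚ (fun x : ZMod m => x + 1)) ^ t) u x = u (x + t) := by
      intro t
      induction t with
      | zero => simp
      | succ t ih =>
        intro u x
        rw [pow_succ, Module.End.mul_apply, ih, LinearMap.funLeft_apply]
        push_cast
        rw [add_assoc]
    rw [LinearMap.proj_apply, h, zero_add, Pi.single_apply]
    simp [ZMod.natCast_eq_zero_iff]

theorem exists_weightedAutomaton_of_finrank_eq (A : Type*) {E : Type} [AddCommGroup E]
    [Module ℚ E] [Module.Finite ℚ E] {n : ℕ} (hn : Module.finrank ℚ E = n) (T : E →ₗ[ℚ] E)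
    (v : E) (φ : E →ₗ[ℚ] ℚ) :
    ∃ W : WeightedAutomaton ℚ A (Fin n), ∀ w : List A, W.weight w = φ ((T ^ w.length) v) := by
  let b := Module.finBasisOfFinrankEq ℚ E hn
  refine ⟨⟨fun _ => LinearMap.toMatrix b b T, fun i => φ (b i), b.repr v⟩, fun w => ?_⟩
  have h : ∀ u : E, (fun i => φ (b i)) ⬝ᵥ (b.repr u : Fin n → ℚ) = φ u := by
    intro u
    conv_rhs => rw [← b.sum_repr u]
    simp only [dotProduct, map_sum, map_smul, smul_eq_mul, mul_comm]
  have hpow : (LinearMap.toMatrix b b T) ^ w.length = LinearMap.toMatrix b b (T ^ w.length) :=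
    (map_pow (LinearMap.toMatrixAlgEquiv b) T w.length).symm
  simp only [WeightedAutomaton.weight, WeightedAutomaton.wordTrans, List.map_const',
    List.prod_replicate, hpow, LinearMap.toMatrix_mulVec_repr, h]

/-- A sequence with a linear representation is computed, as a function of the length of the word,
by a weighted automaton over an arbitrary alphabet. -/
theorem exists_weightedAutomaton (A : Type*) (hf : HasLinearRep D f) {n : ℕ} (hn : D ≤ n) :
    ∃ W : WeightedAutomaton ℚ A (Fin n), ∀ w : List A, W.weight w = f w.length := by
  obtain ⟨E, _, _, _, T, v, φ, hD, hφ⟩ := hf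
  -- A zero block pads the dimension to exactly `n`.
  have hE : Module.finrank ℚ (E × (Fin (n - Module.finrank ℚ E) → ℚ)) = n := by
    rw [Module.finrank_prod, Module.finrank_fin_fun]; omega
  obtain ⟨W, hW⟩ := exists_weightedAutomaton_of_finrank_eq A hE (T.prodMap 0) (v, 0)
    (φ ∘ₗ LinearMap.fst ℚ E _)
  refine ⟨W, fun w => ?_⟩
  have hT : ∀ t, (((T.prodMap (0 : Module.End ℚ (Fin (n - Module.finrank ℚ E) → ℚ))) ^ t) (v, 0)).1
      = (T ^ t) v := by
    intro t
    induction t with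
    | zero => simp
    | succ t ih => simp [pow_succ', ih]
  rw [hW, hφ, LinearMap.comp_apply, LinearMap.fst_apply, hT]

end HasLinearRep

/-! ### The tree of gates: sensitivity and dimension -/

/-- The polynomial of degree two which, on `0`-`1` inputs, tests that the inputs are not all
equal. -/
def notAllEqual (x y z : ℚ) : ℚ := x + y + z - (x * y + x * z + y * z)

/-- The complete ternary tree of height `k` with `notAllEqual` at the inner nodes, evaluated at its
`i`-th copy: the leaves of this copy are the `x j` with `j / 3 ^ k = i`. -/
def notAllEqualTree : ℕ → (ℕ → ℚ) → ℕ → ℚ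
  | 0, x, i => x i
  | k + 1, x, i => notAllEqual (notAllEqualTree k x (3 * i)) (notAllEqualTree k x (3 * i + 1))
      (notAllEqualTree k x (3 * i + 2))

theorem notAllEqualTree_eq_zero_or_one {x : ℕ → ℚ} (hx : ∀ i, x i = 0 ∨ x i = 1) (k i : ℕ) :
    notAllEqualTree k x i = 0 ∨ notAllEqualTree k x i = 1 := by
  induction k generalizing i with
  | zero => exact hx i
  | succ k ih =>
    simp only [notAllEqualTree]
    rcases ih (3 * i) with h | h <;> rcases ih (3 * i + 1) with h' | h' <;>
      rcases ih (3 * i + 2) with h'' | h'' <;> norm_num [h, h', h'', notAllEqual]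

theorem notAllEqualTree_zero (k i : ℕ) : notAllEqualTree k (fun _ => 0) i = 0 := by
  induction k generalizing i with
  | zero => rfl
  | succ k ih => simp [notAllEqualTree, ih, notAllEqual]

/-- Full sensitivity at zero: a gate with exactly one true input outputs 1, so a single true leaf
propagates to the root. -/
theorem notAllEqualTree_single (j k i : ℕ) :
    notAllEqualTree k (fun l => if l = j then 1 else 0) i = if j / 3 ^ k = i then 1 else 0 := by
  induction k generalizing i with
  | zero => simp [notAllEqualTree, eq_comm]
  | succ k ih =>
    rw [pow_succ, ← Nat.div_div_eq_div_mul]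
    simp only [notAllEqualTree, ih, notAllEqual]
    generalize j / 3 ^ k = m
    have hm : m / 3 = i ↔ m = 3 * i ∨ m = 3 * i + 1 ∨ m = 3 * i + 2 := by omega
    rw [if_congr hm rfl rfl]
    split_ifs <;> first | (exfalso; omega) | norm_num

/-- The dimension of `notAllEqualTree k` if all leaves have dimension `B`. -/
def treeDim (B : ℕ) : ℕ → ℕ
  | 0 => B
  | k + 1 => (treeDim B k + treeDim B k + treeDim B k) +
      (treeDim B k * treeDim B k + treeDim B k * treeDim B k + treeDim B k * treeDim B k)

/-- One level sends `d` to `3d + 3d² ≤ 6d²`; scaling by 6 turns this into plain squaring. -/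
theorem six_mul_treeDim_le (B k : ℕ) : 6 * treeDim B k ≤ (6 * B) ^ 2 ^ k := by
  induction k with
  | zero => simp [treeDim]
  | succ k ih =>
    rw [pow_succ, pow_mul]
    refine le_trans ?_ (Nat.pow_le_pow_left ih 2)
    rw [treeDim]
    nlinarith [Nat.le_mul_self (treeDim B k)]

theorem HasLinearRep.notAllEqualTree {B : ℕ} {x : ℕ → ℕ → ℚ} (hx : ∀ i, HasLinearRep B (x i))
    (k i : ℕ) : HasLinearRep (treeDim B k) (fun t => notAllEqualTree k (fun l => x l t) i) := by
  induction k generalizing i with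
  | zero => exact hx i
  | succ k ih =>
    have h0 := ih (3 * i)
    have h1 := ih (3 * i + 1)
    have h2 := ih (3 * i + 2)
    exact ((h0.add h1).add h2).sub (((h0.mul h1).add (h0.mul h2)).add (h1.mul h2))

/-! ### Pumping unary runs of an NFA -/

namespace NFA

variable {A S : Type*} (N : NFA A S)

theorem evalFrom_mono {T T' : Set S} (h : T ⊆ T') (w : List A) :
    N.evalFrom T w ⊆ N.evalFrom T' w := by
  induction w generalizing T T' with
  | nil => simpa using h
  | cons a w ih =>
    rw [evalFrom_cons, evalFrom_cons]
    exact ih (Set.biUnion_subset_biUnion_left h)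

theorem mem_evalFrom_append {T : Set S} {q r : S} {w w' : List A} (hq : q ∈ N.evalFrom T w)
    (hr : r ∈ N.evalFrom {q} w') : r ∈ N.evalFrom T (w ++ w') := by
  rw [evalFrom_append]
  exact N.evalFrom_mono (Set.singleton_subset_iff.2 hq) w' hr

theorem mem_evalFrom_of_path {p : ℕ → S} {a : A} {m : ℕ}
    (hp : ∀ i < m, p (i + 1) ∈ N.step (p i) a) {i j : ℕ} (hj : i + j ≤ m) :
    p (i + j) ∈ N.evalFrom {p i} (List.replicate j a) := by
  induction j with
  | zero => simp
  | succ j ih =>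
    rw [List.replicate_succ']
    refine N.mem_evalFrom_append (ih (by omega)) ?_
    simpa [← add_assoc] using hp (i + j) (by omega)

theorem exists_path_of_mem_evalFrom {T : Set S} {q : S} {a : A} {m : ℕ}
    (hq : q ∈ N.evalFrom T (List.replicate m a)) :
    ∃ p : ℕ → S, p 0 ∈ T ∧ p m = q ∧ ∀ i < m, p (i + 1) ∈ N.step (p i) a := by
  induction m generalizing q with
  | zero => exact ⟨fun _ => q, by simpa using hq, rfl, by simp⟩
  | succ m ih =>
    rw [List.replicate_succ', evalFrom_append, evalFrom_singleton, mem_stepSet] at hq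
    obtain ⟨r, hr, hrq⟩ := hq
    obtain ⟨p, h0, hm, hp⟩ := ih hr
    refine ⟨fun i => if i ≤ m then p i else q, by simpa using h0, by simp, fun i hi => ?_⟩
    rcases Nat.lt_succ_iff_lt_or_eq.1 hi with h | rfl
    · simpa [h, h.le, Nat.succ_le_of_lt h] using hp i h
    · simpa [hm] using hrq

/-- A run on a power of a letter which is at least as long as the number of states can be pumped
at a cycle whose length is at most the number of states. -/
theorem exists_replicate_mem_accepts [Fintype S] {a : A} {m : ℕ} (hm : Fintype.card S ≤ m)
    (h : List.replicate m a ∈ N.accepts) :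
    ∃ l, 0 < l ∧ l ≤ Fintype.card S ∧ ∀ k, List.replicate (m + k * l) a ∈ N.accepts := by
  obtain ⟨q, hqF, hq⟩ := h
  obtain ⟨p, h0, hpm, hp⟩ := N.exists_path_of_mem_evalFrom hq
  have key : ∃ i j, i < j ∧ j ≤ Fintype.card S ∧ p i = p j := by
    obtain ⟨i, j, hij, h⟩ := Fintype.exists_ne_map_eq_of_card_lt
      (fun i : Fin (Fintype.card S + 1) => p i) (by simp)
    rcases lt_or_gt_of_ne hij with h' | h'
    · exact ⟨i, j, h', by omega, h⟩
    · exact ⟨j, i, h', by omega, h.symm⟩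
  obtain ⟨i, j, hij, hj, hpij⟩ := key
  refine ⟨j - i, by omega, by omega, fun k => ⟨q, hqF, ?_⟩⟩
  have hcycle : ∀ k, p i ∈ N.evalFrom {p i} (List.replicate (k * (j - i)) a) := by
    intro k
    induction k with
    | zero => simp
    | succ k ih =>
      rw [Nat.succ_mul, List.replicate_add]
      refine N.mem_evalFrom_append ih ?_
      have := N.mem_evalFrom_of_path hp (i := i) (j := j - i) (by omega)
      rwa [Nat.add_sub_cancel' hij.le, ← hpij] at this
  have hfirst := N.mem_evalFrom_of_path hp (i := 0) (j := i) (by omega)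
  have hlast := N.mem_evalFrom_of_path hp (i := j) (j := m - j) (by omega)
  rw [Nat.add_sub_cancel' (hj.trans hm), hpm, ← hpij] at hlast
  rw [zero_add] at hfirst
  have hloop := hcycle (k + 1)
  have hsplit : m + k * (j - i) = i + ((k + 1) * (j - i) + (m - j)) := by
    rw [Nat.succ_mul]; omega
  rw [hsplit, List.replicate_add, List.replicate_add]
  exact N.evalFrom_mono (Set.singleton_subset_iff.2 h0) _
    (N.mem_evalFrom_append hfirst (N.mem_evalFrom_append hloop hlast))

end NFA

/-! ### Divisibility leaves and the lower bound for NFAs -/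

theorem exists_primes_between (P : ℕ) (hP : 0 < P) :
    ∃ p : ℕ → ℕ, Function.Injective p ∧
      ∀ i, (p i).Prime ∧ P < p i ∧ p i ≤ 2 ^ (i + 1) * P := by
  -- Bertrand's postulate in consecutive dyadic intervals makes the primes distinct.
  have h : ∀ i, ∃ q, Nat.Prime q ∧ 2 ^ i * P < q ∧ q ≤ 2 * (2 ^ i * P) := fun i =>
    Nat.exists_prime_lt_and_le_two_mul (2 ^ i * P) (by positivity)
  choose p hp hlt hle using h
  have hle' : ∀ i, p i ≤ 2 ^ (i + 1) * P := fun i => (hle i).trans_eq (by ring)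
  refine ⟨p, (strictMono_nat_of_lt_succ fun i => (hle' i).trans_lt (hlt (i + 1))).injective,
    fun i => ⟨hp i, ?_, hle' i⟩⟩
  exact lt_of_le_of_lt (Nat.le_mul_of_pos_left P (by positivity)) (hlt i)

/-- The indicators of the divisibility by the first `h` members of `p`. -/
def divLeaf (p : ℕ → ℕ) (h i t : ℕ) : ℚ := if i < h ∧ p i ∣ t then 1 else 0

theorem hasLinearRep_divLeaf {p : ℕ → ℕ} {h B : ℕ} (hp : ∀ i < h, p i ≠ 0 ∧ p i ≤ B)
    (hB : 0 < B) (i : ℕ) : HasLinearRep B (divLeaf p h i) := by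
  by_cases hi : i < h
  · have : divLeaf p h i = fun t => if p i ∣ t then 1 else 0 := by
      funext t; simp [divLeaf, hi]
    rw [this]
    exact (HasLinearRep.dvd_indicator (p i) (hp i hi).1).mono (hp i hi).2
  · have : divLeaf p h i = fun _ => 0 := by funext t; simp [divLeaf, hi]
    rw [this]
    exact (HasLinearRep.const 0).mono hB

/-- One minus the tree of `notAllEqual` gates at the indicators of the divisibility by the first
`3 ^ k` members of `p`. -/
def treeSeq (p : ℕ → ℕ) (k t : ℕ) : ℚ :=
  1 - notAllEqualTree k (fun i => divLeaf p (3 ^ k) i t) 0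

theorem treeSeq_eq_zero_or_one (p : ℕ → ℕ) (k t : ℕ) : treeSeq p k t = 0 ∨ treeSeq p k t = 1 := by
  have hx : ∀ i, divLeaf p (3 ^ k) i t = 0 ∨ divLeaf p (3 ^ k) i t = 1 := by
    intro i; unfold divLeaf; split_ifs <;> simp
  rcases notAllEqualTree_eq_zero_or_one hx k 0 with h | h <;> simp [treeSeq, h]

theorem treeSeq_eq_one {p : ℕ → ℕ} {k t : ℕ} (h : ∀ i < 3 ^ k, ¬ p i ∣ t) : treeSeq p k t = 1 := by
  have : (fun i => divLeaf p (3 ^ k) i t) = fun _ => 0 := by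
    funext i
    exact if_neg fun hi => h i hi.1 hi.2
  simp [treeSeq, this, notAllEqualTree_zero]

theorem treeSeq_eq_zero {p : ℕ → ℕ} {k t j : ℕ} (hj : j < 3 ^ k)
    (h : ∀ i < 3 ^ k, p i ∣ t ↔ i = j) : treeSeq p k t = 0 := by
  have : (fun i => divLeaf p (3 ^ k) i t) = fun i => if i = j then 1 else 0 := by
    funext i
    refine if_congr ⟨fun hi => (h i hi.1).1 hi.2, ?_⟩ rfl rfl
    rintro rfl
    exact ⟨hj, (h i hj).2 rfl⟩
  simp [treeSeq, this, notAllEqualTree_single, Nat.div_eq_of_lt hj]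

theorem prod_dvd_of_treeSeq_eq_one {p : ℕ → ℕ} {k t l : ℕ} (hinj : Function.Injective p)
    (hp : ∀ i, (p i).Prime) (ht : ∀ i < 3 ^ k, t ≡ 1 [MOD p i])
    (h : ∀ m, treeSeq p k (t + m * l) = 1) : ∏ i ∈ Finset.range (3 ^ k), p i ∣ l := by
  refine Finset.prod_dvd_of_isRelPrime (fun i _ j _ hij => Nat.coprime_iff_isRelPrime.1
    ((Nat.coprime_primes (hp i) (hp j)).2 (hinj.ne hij))) fun j hj => ?_
  rw [Finset.mem_range] at hj
  by_contra hjl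
  set R := ∏ i ∈ (Finset.range (3 ^ k)).erase j, p i with hR
  have hcop : Nat.Coprime (R * l) (p j) := by
    refine Nat.Coprime.mul_left (Nat.Coprime.prod_left fun i hi => ?_)
      ((Nat.Prime.coprime_iff_not_dvd (hp j)).2 hjl).symm
    exact (Nat.coprime_primes (hp i) (hp j)).2 (hinj.ne (Finset.ne_of_mem_erase hi))
  have : Fact (p j).Prime := ⟨hp j⟩
  have hne : ((R * l : ℕ) : ZMod (p j)) ≠ 0 := by
    rw [Ne, ZMod.natCast_eq_zero_iff]
    exact (Nat.Prime.coprime_iff_not_dvd (hp j)).1 hcop.symm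
  -- Adding `m * R * l` to `t` makes it 0 modulo `p j`, while the factor `R` keeps it 1 modulo the
  -- other primes.
  set m := (-(t : ZMod (p j)) / ((R * l : ℕ) : ZMod (p j))).val with hm
  have hzero : treeSeq p k (t + m * R * l) = 0 := by
    refine treeSeq_eq_zero hj fun i hi => ⟨fun hd => ?_, ?_⟩
    · by_contra hij
      have hiR : p i ∣ m * R * l :=
        ((Finset.dvd_prod_of_mem p (Finset.mem_erase.2 ⟨hij, Finset.mem_range.2 hi⟩)).mul_left
          m).mul_right l
      have hit : p i ∣ t := (Nat.dvd_add_left hiR).1 hd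
      exact (hp i).one_lt.ne' (Nat.dvd_one.1 (((ht i hi).dvd_iff dvd_rfl).1 hit))
    · rintro rfl
      rw [← ZMod.natCast_eq_zero_iff, mul_assoc, Nat.cast_add, Nat.cast_mul m, hm,
        ZMod.natCast_zmod_val, div_mul_cancel₀ _ hne, add_neg_cancel]
  exact zero_ne_one (hzero.symm.trans (h (m * R)))

theorem prod_le_card_of_accepts_eq {A S : Type*} [Nonempty A] [Fintype S] {p : ℕ → ℕ} {k : ℕ}
    (hinj : Function.Injective p) (hp : ∀ i, (p i).Prime) (N : NFA A S)
    (hN : ∀ w : List A, w ∈ N.accepts ↔ treeSeq p k w.length = 1) :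
    ∏ i ∈ Finset.range (3 ^ k), p i ≤ Fintype.card S := by
  obtain ⟨a⟩ := ‹Nonempty A›
  set R := ∏ i ∈ Finset.range (3 ^ k), p i with hR
  have hR0 : 0 < R := Finset.prod_pos fun i _ => (hp i).pos
  have hmod : ∀ i < 3 ^ k, 1 + R * Fintype.card S ≡ 1 [MOD p i] := by
    intro i hi
    have : p i ∣ R * Fintype.card S :=
      (Finset.dvd_prod_of_mem p (Finset.mem_range.2 hi)).mul_right _
    simpa using (Nat.ModEq.refl 1).add ((Nat.modEq_zero_iff_dvd).2 this)
  -- This length is 1 modulo every `p i`, hence accepted, and long enough to pump.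
  obtain ⟨l, hl0, hl, hacc⟩ := N.exists_replicate_mem_accepts (a := a)
    (m := 1 + R * Fintype.card S) (by nlinarith) (by
      rw [hN, List.length_replicate]
      refine treeSeq_eq_one fun i hi hd => (hp i).one_lt.ne' (Nat.dvd_one.1 ?_)
      exact ((hmod i hi).dvd_iff dvd_rfl).1 hd)
  refine (Nat.le_of_dvd hl0 (prod_dvd_of_treeSeq_eq_one hinj hp hmod fun m => ?_)).trans hl
  simpa [hN] using hacc m

/-! ### Choice of parameters and conclusion -/

theorem exists_mul_two_pow_lt_three_pow (c : ℕ) : ∃ k, c * 2 ^ k < 3 ^ k := by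
  obtain ⟨k, hk⟩ := pow_unbounded_of_one_lt (c : ℚ) (by norm_num : (1 : ℚ) < 3 / 2)
  refine ⟨k, ?_⟩
  rw [div_pow, lt_div_iff₀ (by positivity)] at hk
  exact_mod_cast hk

/-- The size parameter is recovered, up to a constant factor, from the number of states. -/
theorem exists_mul_pow_le_and_pow_le {K d c : ℕ} (hK : 0 < K) (hd : 0 < d) :
    ∃ n₀ : ℕ, ∀ n, n₀ ≤ n → ∃ P, 0 < P ∧ K * P ^ d ≤ n ∧ n ^ c ≤ P ^ (c * d + 1) := by
  -- For the largest admissible `P`, `n < K * (P + 1) ^ d ≤ K * (2 * P) ^ d`; the constant of the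
  -- `c`-th power is `P₀`, absorbed by one extra factor `P`.
  set P₀ := (K * 2 ^ d) ^ c with hP₀
  have hP₀pos : 0 < P₀ := by positivity
  refine ⟨K * P₀ ^ d, fun n hn => ?_⟩
  set P := Nat.findGreatest (fun P => K * P ^ d ≤ n) n with hP
  have hle : ∀ {Q}, K * Q ^ d ≤ n → Q ≤ n := fun {Q} h =>
    (Nat.le_self_pow hd.ne' Q).trans ((Nat.le_mul_of_pos_left _ hK).trans h)
  have hP0P : P₀ ≤ P := Nat.le_findGreatest (hle hn) hn
  have hPn : K * P ^ d ≤ n := Nat.findGreatest_spec (P := fun P => K * P ^ d ≤ n) (hle hn) hn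
  have hPpos : 0 < P := hP₀pos.trans_le hP0P
  have hlt : n < K * (P + 1) ^ d := by
    by_contra! hcon
    have := Nat.le_findGreatest (P := fun P => K * P ^ d ≤ n) (hle hcon) hcon
    omega
  refine ⟨P, hPpos, hPn, ?_⟩
  calc n ^ c ≤ (K * (2 * P) ^ d) ^ c := by
        refine Nat.pow_le_pow_left (hlt.le.trans ?_) c
        gcongr
        omega
    _ = P₀ * P ^ (c * d) := by rw [hP₀, mul_comm c d, pow_mul, ← mul_pow]; ring
    _ ≤ P * P ^ (c * d) := by gcongr
    _ = P ^ (c * d + 1) := by rw [pow_succ, mul_comm]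

/-- Converting image-binary finite automata (over the rationals) to nondeterministic finite
automata requires a super-polynomial state blowup, over every nonempty finite alphabet (in
particular over a one-letter alphabet). -/
theorem mainTheorem12 (A : Type*) [Fintype A] [Nonempty A] :
    ∀ c : ℕ, ∃ n₀ : ℕ, ∀ n : ℕ, n₀ ≤ n →
      ∃ W : WeightedAutomaton ℚ A (Fin n), W.IsImageBinary ∧
        ∀ (S : Type*) [Fintype S] (N : NFA A S),
          N.accepts = W.accepts → n ^ c < Fintype.card S := by
  intro c
  obtain ⟨k, hk⟩ := exists_mul_two_pow_lt_three_pow c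
  obtain ⟨n₀, hn₀⟩ := exists_mul_pow_le_and_pow_le (K := (6 * 2 ^ 3 ^ k) ^ 2 ^ k) (d := 2 ^ k)
    (c := c) (by positivity) (by positivity)
  refine ⟨n₀, fun n hn => ?_⟩
  obtain ⟨P, hP, hPn, hnP⟩ := hn₀ n hn
  obtain ⟨p, hinj, hp⟩ := exists_primes_between P hP
  have hrep : HasLinearRep (1 + treeDim (2 ^ 3 ^ k * P) k) (treeSeq p k) :=
    (HasLinearRep.const 1).sub (HasLinearRep.notAllEqualTree
      (hasLinearRep_divLeaf (fun i hi => ⟨(hp i).1.ne_zero, (hp i).2.2.trans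
        (Nat.mul_le_mul_right P (Nat.pow_le_pow_right two_pos hi))⟩) (by positivity)) k 0)
  have hdim : 1 + treeDim (2 ^ 3 ^ k * P) k ≤ n := by
    refine le_trans ?_ hPn
    have h6 := six_mul_treeDim_le (2 ^ 3 ^ k * P) k
    rw [← mul_assoc, mul_pow] at h6
    have : 0 < (6 * 2 ^ 3 ^ k) ^ 2 ^ k * P ^ 2 ^ k := by positivity
    omega
  obtain ⟨W, hW⟩ := hrep.exists_weightedAutomaton A hdim
  refine ⟨W, fun w => by simpa only [hW] using treeSeq_eq_zero_or_one p k w.length,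
    fun S _ N hN => ?_⟩
  have hcard : ∏ i ∈ Finset.range (3 ^ k), p i ≤ Fintype.card S :=
    prod_le_card_of_accepts_eq hinj (fun i => (hp i).1) N fun w => by
      rw [hN, ← hW w]; rfl
  calc n ^ c ≤ P ^ (c * 2 ^ k + 1) := hnP
    _ ≤ P ^ 3 ^ k := Nat.pow_le_pow_right hP hk
    _ = ∏ _i ∈ Finset.range (3 ^ k), P := by simp
    _ < ∏ i ∈ Finset.range (3 ^ k), p i :=
        Finset.prod_lt_prod_of_nonempty (fun _ _ => hP) (fun i _ => (hp i).2.1)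
          (Finset.nonempty_range_iff.2 (by positivity))
    _ ≤ Fintype.card S := hcard
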